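/- Let $p$ be any prime (including $p=2$) and let $P$ be a finite $p$-group. A fusion system $\mathcal F$ on $P$ is a category whose objects are the subgroups of $P$, whose morphism sets $\mathrm{Hom}_{\mathcal F}(Q,R)$ consist of injective group homomorphisms $Q\to R$ (composed as maps), and which contains all inclusions and all homomorphisms $Q\to R$ induced by conjugation with an element of $P$, and, with each morphism $\varphi\colon Q\to R$, the induced isomorphism $Q\to\varphi(Q)$ and its inverse. A subgroup $Q\le P$ is fully $\mathcal F$-normalized if $|N_P(Q)|\ge |N_P(R)|$ for every $R$ that is $\mathcal F$-isomorphic to $Q$. The fusion system $\mathcal F$ is saturated if $\mathrm{Aut}_P(P)$ is a Sylow $p$-subgroup of $\mathrm{Aut}_{\mathcal F}(P)$, and every $\varphi\in\mathrm{Hom}_{\mathcal F}(Q,P)$ with $\varphi(Q)$ fully $\mathcal F$-normalized extends to a morphism in $\mathrm{Hom}_{\mathcal F}(N_\varphi,P)$, where $N_\varphi$ is the group of all $g\in N_P(Q)$ such that $\varphi\circ c_g|_Q\circ\varphi^{-1}\in \mathrm{Aut}_P(\varphi(Q))$, with $c_g$ denoting conjugation by $g$. For $Q\le P$, write $\mathcal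 F_Q(Q)$ for the fusion system on $Q$ whose morphisms are exactly the homomorphisms induced by conjugation with elements of $Q$. A saturated fusion system $\mathcal F$ on $P$ is called extremely sparse if $\mathcal F\ne\mathcal F_P(P)$ and, for every subgroup $Q\le P$, every saturated fusion system $\mathcal G$ on $Q$ that is a subcategory of $\mathcal F$ with $\mathcal G\neq\mathcal F$ is equal to $\mathcal F_Q(Q)$. A subgroup $Q\le P$ is $\mathcal F$-centric if $C_P(R)\le R$ for every $R$ that is $\mathcal F$-isomorphic to $Q$. The normalizer $N_{\mathcal F}(Q)$ is the category on the subgroups of $N_P(Q)$ whose morphisms are those $\phi\in\mathrm{Hom}_{\mathcal F}(R,S)$ that extend to some $\psi\in\mathrm{Hom}_{\mathcal F}(QR,QS)$ with $\psi(Q)=Q$; $Q$ is normal in $\mathcal F$ if $N_{\mathcal F}(Q)=\mathcal F$; and $\mathcal F$ is constrained if it has a normal $\mathcal F$-centric subgroup. **Theorem.** Every extremely sparse saturated fusion system on a finite $p$-group is constrained. -/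

import Mathlib

/-! Fusion systems on subgroups `S` of a group `P`.  Everything lives inside the fixed group `P`, so
that a fusion system on `P` itself (carrier `⊤`) and its subsystems on subgroups of `P` are objects
of the same type and can be compared directly. -/

namespace Fusion

variable {P : Type*} [Group P]

/-- The image `φ(A ∩ Q)`, as a subgroup of `P`, for a homomorphism `φ : Q → R` between subgroups
of `P`; for `A ≤ Q` it is `φ(A)`. -/
def image {Q R : Subgroup P} (φ : Q →* R) (A : Subgroup P) : Subgroup P :=
  ((A.subgroupOf Q).map φ).map R.subtype

/-- `ψ : Q' → R'` extends `φ : Q → R`, i.e. `Q ≤ Q'` and both agree on `Q` as maps into `P`. -/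
def Extends {Q' R' Q R : Subgroup P} (ψ : Q' →* R') (φ : Q →* R) : Prop :=
  ∃ h : Q ≤ Q', ∀ x : Q, (ψ (Subgroup.inclusion h x) : P) = φ x

theorem mem_image {Q R : Subgroup P} (φ : Q →* R) (A : Subgroup P) (y : P) :
    y ∈ image φ A ↔ ∃ x : Q, (x : P) ∈ A ∧ (φ x : P) = y := by
  simp only [image, Subgroup.mem_map, Subgroup.mem_subgroupOf, Subgroup.coe_subtype]
  constructor
  · rintro ⟨_, ⟨x, hx, rfl⟩, rfl⟩
    exact ⟨x, hx, rfl⟩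
  · rintro ⟨x, hx, rfl⟩
    exact ⟨_, ⟨x, hx, rfl⟩, rfl⟩

theorem mem_of_image_eq {Q R A B : Subgroup P} {φ : Q →* R} (h : image φ A = B) (y : P) :
    y ∈ B ↔ ∃ x : Q, (x : P) ∈ A ∧ (φ x : P) = y := by
  rw [← h, mem_image]

end Fusion

/-- A fusion system on the subgroup `S = carrier` of `P`: a category whose objects are the
subgroups of `S` and whose morphisms `Hom Q R` are injective group homomorphisms `Q → R`, composed
as maps, that contains all inclusions, contains with every morphism `φ : Q → R` the induced
isomorphism `Q → φ(Q)` and its inverse, and contains all homomorphisms induced by conjugation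
with an element of `S`. (`Hom Q R` is empty if `Q` or `R` is not a subgroup of `S`.) -/
@[ext]
structure FusionSystem (P : Type*) [Group P] where
  carrier : Subgroup P
  Hom : (Q R : Subgroup P) → Set (Q →* R)
  le_carrier_left : ∀ {Q R : Subgroup P} {φ : Q →* R}, φ ∈ Hom Q R → Q ≤ carrier
  le_carrier_right : ∀ {Q R : Subgroup P} {φ : Q →* R}, φ ∈ Hom Q R → R ≤ carrier
  injective : ∀ {Q R : Subgroup P} {φ : Q →* R}, φ ∈ Hom Q R → Function.Injective φ
  comp_mem : ∀ {Q R T : Subgroup P} {φ : Q →* R} {ψ : R →* T},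
    φ ∈ Hom Q R → ψ ∈ Hom R T → ψ.comp φ ∈ Hom Q T
  inclusion_mem : ∀ {Q R : Subgroup P} (h : Q ≤ R), R ≤ carrier →
    Subgroup.inclusion h ∈ Hom Q R
  iso_mem : ∀ {Q R T : Subgroup P} {φ : Q →* R} (e : Q ≃* T), φ ∈ Hom Q R →
    (∀ x : Q, (e x : P) = φ x) → e.toMonoidHom ∈ Hom Q T ∧ e.symm.toMonoidHom ∈ Hom T Q
  conj_mem : ∀ {Q R : Subgroup P} (φ : Q →* R), Q ≤ carrier → R ≤ carrier →
    ∀ g ∈ carrier, (∀ x : Q, (φ x : P) = g * x * g⁻¹) → φ ∈ Hom Q R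

namespace FusionSystem

variable {P : Type*} [Group P]

/-- The fusion system `F_S(S)` of the group `S` on itself. -/
def inner (S : Subgroup P) : FusionSystem P where
  carrier := S
  Hom Q R := {φ | Q ≤ S ∧ R ≤ S ∧ ∃ g ∈ S, ∀ x : Q, (φ x : P) = g * x * g⁻¹}
  le_carrier_left h := h.1
  le_carrier_right h := h.2.1
  injective := by
    rintro Q R φ ⟨_, _, g, _, h⟩ x y hxy
    have h1 := h x
    rw [hxy, h y] at h1
    exact Subtype.ext (by simpa using h1.symm)
  comp_mem := by
    rintro Q R T φ ψ ⟨hQ, _, g, hg, h⟩ ⟨_, hT, k, hk, h'⟩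
    refine ⟨hQ, hT, k * g, S.mul_mem hk hg, fun x => ?_⟩
    simp [h', h, mul_assoc]
  inclusion_mem h hR := ⟨h.trans hR, hR, 1, S.one_mem, fun x => by simp⟩
  iso_mem := by
    rintro Q R T φ e ⟨hQ, hR, g, hg, h⟩ he
    have hT : T ≤ S := by
      intro y hy
      have h1 := he (e.symm ⟨y, hy⟩)
      rw [e.apply_symm_apply] at h1
      rw [show y = _ from h1]
      exact hR (φ _).2
    refine ⟨⟨hQ, hT, g, hg, fun x => (he x).trans (h x)⟩,
      ⟨hT, hQ, g⁻¹, S.inv_mem hg, fun y => ?_⟩⟩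
    have h1 := (he (e.symm y)).trans (h _)
    rw [e.apply_symm_apply] at h1
    rw [h1]
    simp [mul_assoc]
  conj_mem φ hQ hR g hg h := ⟨hQ, hR, g, hg, h⟩

/-- A fusion system on `S` is trivial if it is `F_S(S)`. -/
def IsTrivial (F : FusionSystem P) : Prop := F = inner F.carrier

/-- `G` is a subcategory of `F`. -/
def IsSubsystem (G F : FusionSystem P) : Prop :=
  G.carrier ≤ F.carrier ∧ ∀ Q R : Subgroup P, G.Hom Q R ⊆ F.Hom Q R

/-- The group `Aut_F(Q)`. -/
def aut (F : FusionSystem P) (Q : Subgroup P) (hQ : Q ≤ F.carrier) : Subgroup (MulAut Q) where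
  carrier := {α | MulEquiv.toMonoidHom α ∈ F.Hom Q Q}
  one_mem' := F.inclusion_mem le_rfl hQ
  mul_mem' ha hb := F.comp_mem hb ha
  inv_mem' {a} ha := (F.iso_mem a ha fun _ => rfl).2

/-- The group `Aut_S(Q)` of automorphisms of `Q` induced by conjugation with elements of `S`
(necessarily in `N_S(Q)`). -/
abbrev innerAut (S Q : Subgroup P) (hQ : Q ≤ S) : Subgroup (MulAut Q) := (inner S).aut Q hQ

/-- `R` lies in the `F`-isomorphism class of `Q`. -/
def IsIsomorphic (F : FusionSystem P) (Q R : Subgroup P) : Prop :=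
  ∃ e : Q ≃* R, e.toMonoidHom ∈ F.Hom Q R

/-- The normalizer `N_S(Q)`. -/
def normIn (S Q : Subgroup P) : Subgroup P := S ⊓ Subgroup.normalizer (Q : Set P)

/-- The centralizer `C_S(Q)`. -/
def centIn (S Q : Subgroup P) : Subgroup P := S ⊓ Subgroup.centralizer (Q : Set P)

/-- `Q` is fully `F`-normalized. -/
def FullyNormalized (F : FusionSystem P) (Q : Subgroup P) : Prop :=
  Q ≤ F.carrier ∧ ∀ R, F.IsIsomorphic Q R →
    Nat.card (normIn F.carrier R) ≤ Nat.card (normIn F.carrier Q)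

/-- For `φ : Q → R`, the group `N_φ` of all `g ∈ N_S(Q)` such that `φ ∘ c_g ∘ φ⁻¹` lies in
`Aut_S(φ(Q))`, i.e. is conjugation by some `h ∈ S`. Here `c_g(x) = g x g⁻¹`. -/
def extender (S : Subgroup P) {Q R : Subgroup P} (φ : Q →* R) : Subgroup P where
  carrier := {g | g ∈ normIn S Q ∧ ∃ h ∈ S, ∀ x y : Q, (y : P) = g * x * g⁻¹ →
    (φ y : P) = h * φ x * h⁻¹}
  one_mem' := ⟨one_mem _, 1, one_mem _, fun x y hxy => by
    have : y = x := Subtype.ext (by simpa using hxy)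
    simp [this]⟩
  mul_mem' := by
    rintro a b ⟨ha, h, hh, Ha⟩ ⟨hb, k, hk, Hb⟩
    refine ⟨mul_mem ha hb, h * k, mul_mem hh hk, fun x y hxy => ?_⟩
    have hz : b * x * b⁻¹ ∈ Q := (Subgroup.mem_normalizer_iff.1 hb.2 x).1 x.2
    rw [Ha ⟨_, hz⟩ y (by simp [hxy, mul_assoc]), Hb x ⟨_, hz⟩ rfl]
    simp [mul_assoc]
  inv_mem' := by
    rintro a ⟨ha, h, hh, Ha⟩
    refine ⟨inv_mem ha, h⁻¹, inv_mem hh, fun x y hxy => ?_⟩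
    rw [Ha y x (by simp [hxy, mul_assoc])]
    simp [mul_assoc]

/-- The fusion system `F` is saturated at the prime `p`: the Sylow axiom and the extension axiom,
where `S` is the carrier of `F`. -/
structure IsSaturated (p : ℕ) (F : FusionSystem P) : Prop where
  /-- `Aut_S(S)` is a Sylow `p`-subgroup of `Aut_F(S)`. -/
  sylow : ∃ T : Sylow p (F.aut F.carrier le_rfl),
    (T : Subgroup (F.aut F.carrier le_rfl)) =
      (innerAut F.carrier F.carrier le_rfl).subgroupOf (F.aut F.carrier le_rfl)
  /-- If `φ(Q)` is fully `F`-normalized, then `φ` extends to a morphism on `N_φ`. -/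
  extension : ∀ (Q : Subgroup P) (φ : Q →* F.carrier), φ ∈ F.Hom Q F.carrier →
    F.FullyNormalized (Fusion.image φ Q) →
      ∃ ψ ∈ F.Hom (extender F.carrier φ) F.carrier, Fusion.Extends ψ φ

/-- `Q` is `F`-centric. -/
def Centric (F : FusionSystem P) (Q : Subgroup P) : Prop :=
  Q ≤ F.carrier ∧ ∀ R, F.IsIsomorphic Q R → centIn F.carrier R ≤ R

/-- The normalizer `N_F(Q)`: the fusion system on `N_S(Q)` whose morphisms are the morphisms
`φ : R → T` of `F` between subgroups of `N_S(Q)` that extend to a morphism `ψ : QR → QT` of `F`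
with `ψ(Q) = Q`. (`Q ⊔ R = QR`, since `R` normalizes `Q`.) -/
def normalizer (F : FusionSystem P) (Q : Subgroup P) (hQ : Q ≤ F.carrier) : FusionSystem P where
  carrier := normIn F.carrier Q
  Hom R T := {φ | R ≤ normIn F.carrier Q ∧ T ≤ normIn F.carrier Q ∧ φ ∈ F.Hom R T ∧
    ∃ ψ ∈ F.Hom (Q ⊔ R) (Q ⊔ T), Fusion.Extends ψ φ ∧ Fusion.image ψ Q = Q}
  le_carrier_left h := h.1
  le_carrier_right h := h.2.1
  injective h := F.injective h.2.2.1
  comp_mem := by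
    rintro R T U φ φ' ⟨hR, _, hφ, ψ, hψ, ⟨_, he⟩, hi⟩ ⟨_, hU, hφ', ψ', hψ', ⟨_, he'⟩, hi'⟩
    refine ⟨hR, hU, F.comp_mem hφ hφ', _, F.comp_mem hψ hψ', ⟨le_sup_right, fun x => ?_⟩, ?_⟩
    · have h1 : ψ (Subgroup.inclusion le_sup_right x) =
          Subgroup.inclusion le_sup_right (φ x) := Subtype.ext (he x)
      rw [MonoidHom.comp_apply, h1]
      exact he' _
    · ext y
      rw [Fusion.mem_image]
      constructor
      · rintro ⟨x, hx, rfl⟩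
        exact (Fusion.mem_of_image_eq hi' _).2
          ⟨ψ x, (Fusion.mem_of_image_eq hi _).2 ⟨x, hx, rfl⟩, rfl⟩
      · intro hy
        obtain ⟨z, hz, rfl⟩ := (Fusion.mem_of_image_eq hi' _).1 hy
        obtain ⟨x, hx, hxz⟩ := (Fusion.mem_of_image_eq hi _).1 hz
        refine ⟨x, hx, ?_⟩
        rw [MonoidHom.comp_apply, Subtype.ext hxz]
  inclusion_mem := by
    intro R T h hT
    have hTS : T ≤ F.carrier := hT.trans inf_le_left
    refine ⟨h.trans hT, hT, F.inclusion_mem h hTS, Subgroup.inclusion (sup_le_sup_left h Q),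
      F.inclusion_mem _ (sup_le hQ hTS), ⟨le_sup_right, fun x => rfl⟩, ?_⟩
    ext y
    rw [Fusion.mem_image]
    constructor
    · rintro ⟨x, hx, rfl⟩
      exact hx
    · intro hy
      exact ⟨⟨y, le_sup_left (a := Q) (b := R) hy⟩, hy, rfl⟩
  iso_mem := by
    rintro R T U φ e ⟨hR, hT, hφ, ψ, hψ, ⟨_, he⟩, hi⟩ heφ
    have hUT : U ≤ T := by
      intro y hy
      have h1 := heφ (e.symm ⟨y, hy⟩)
      rw [e.apply_symm_apply] at h1
      rw [show y = _ from h1]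
      exact (φ _).2
    have hU := hUT.trans hT
    have hRQ : ∀ x : R, (x : P) ∈ Q ⊔ R := fun x => le_sup_right (a := Q) x.2
    let f : ↥(Q ⊔ R) →* P := (Q ⊔ T).subtype.comp ψ
    have hf : Function.Injective f := Subtype.val_injective.comp (F.injective hψ)
    have hrange : f.range = Q ⊔ U := by
      rw [MonoidHom.range_eq_map, ← Subgroup.subgroupOf_self (Q ⊔ R),
        Subgroup.subgroupOf_sup le_sup_left le_sup_right, Subgroup.map_sup]
      congr 1
      · rw [← Subgroup.map_map]
        exact hi
      · ext y
        simp only [Subgroup.mem_map, Subgroup.mem_subgroupOf]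
        constructor
        · rintro ⟨x, hx, rfl⟩
          have h1 := (he ⟨x, hx⟩).trans (heφ ⟨x, hx⟩).symm
          exact (show f x = _ from h1) ▸ (e ⟨x, hx⟩).2
        · intro hy
          refine ⟨⟨e.symm ⟨y, hy⟩, hRQ _⟩, (e.symm ⟨y, hy⟩).2, ?_⟩
          have h1 := (he (e.symm ⟨y, hy⟩)).trans (heφ _).symm
          rw [e.apply_symm_apply] at h1
          exact h1
    let e' : ↥(Q ⊔ R) ≃* ↥(Q ⊔ U) :=
      (MonoidHom.ofInjective hf).trans (MulEquiv.subgroupCongr hrange)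
    have he' : ∀ x, (e' x : P) = ψ x := fun x => rfl
    obtain ⟨h1, h2⟩ := F.iso_mem e' hψ he'
    obtain ⟨h3, h4⟩ := F.iso_mem e hφ heφ
    have hxe : ∀ x : R, e' (Subgroup.inclusion le_sup_right x) =
        Subgroup.inclusion le_sup_right (e x) := fun x =>
      Subtype.ext ((he x).trans (heφ x).symm)
    refine ⟨⟨hR, hU, h3, _, h1, ⟨le_sup_right, fun x => (he x).trans (heφ x).symm⟩, ?_⟩,
      ⟨hU, hR, h4, _, h2, ⟨le_sup_right, fun y => ?_⟩, ?_⟩⟩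
    · conv_rhs => rw [← hi]
      ext y
      rw [Fusion.mem_image, Fusion.mem_image]
      rfl
    · have h5 := hxe (e.symm y)
      rw [e.apply_symm_apply, ← MulEquiv.eq_symm_apply] at h5
      exact congrArg Subtype.val h5.symm
    · ext y
      rw [Fusion.mem_image]
      constructor
      · rintro ⟨x, hx, rfl⟩
        obtain ⟨z, hz, hzx⟩ := (Fusion.mem_of_image_eq hi _).1 hx
        have h5 : e' z = x := Subtype.ext hzx
        rw [← h5]
        simpa using hz
      · intro hy
        refine ⟨e' ⟨y, le_sup_left (a := Q) hy⟩, ?_, ?_⟩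
        · rw [he']
          have : (ψ ⟨y, le_sup_left (a := Q) hy⟩ : P) ∈ Fusion.image ψ Q :=
            (Fusion.mem_image _ _ _).2 ⟨_, hy, rfl⟩
          rwa [hi] at this
        · simp
  conj_mem := by
    intro R T φ hR hT g hg h
    have hRS : R ≤ F.carrier := hR.trans inf_le_left
    have hTS : T ≤ F.carrier := hT.trans inf_le_left
    have hle : Q ⊔ R ≤ (Q ⊔ T).comap (MulAut.conj g).toMonoidHom := by
      refine sup_le (fun x hx => ?_) (fun x hx => ?_)
      · exact le_sup_left (a := Q) ((Subgroup.mem_normalizer_iff.1 hg.2 x).1 hx)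
      · have h1 := (φ ⟨x, hx⟩).2
        rw [h] at h1
        exact le_sup_right (a := Q) h1
    let ψ : ↥(Q ⊔ R) →* ↥(Q ⊔ T) :=
      ((MulAut.conj g).toMonoidHom.comp (Q ⊔ R).subtype).codRestrict (Q ⊔ T) fun x => hle x.2
    have hψ : ∀ x, (ψ x : P) = g * x * g⁻¹ := fun x => rfl
    refine ⟨hR, hT, F.conj_mem φ hRS hTS g hg.1 h, ψ,
      F.conj_mem ψ (sup_le hQ hRS) (sup_le hQ hTS) g hg.1 hψ,
      ⟨le_sup_right, fun x => (h x).symm⟩, ?_⟩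
    ext y
    rw [Fusion.mem_image]
    constructor
    · rintro ⟨x, hx, rfl⟩
      rw [hψ]
      exact (Subgroup.mem_normalizer_iff.1 hg.2 x).1 hx
    · intro hy
      have h1 : g⁻¹ * y * g ∈ Q := by
        rw [Subgroup.mem_normalizer_iff.1 hg.2]
        simpa [mul_assoc] using hy
      exact ⟨⟨_, le_sup_left (a := Q) h1⟩, h1, by rw [hψ]; simp [mul_assoc]⟩

/-- `Q` is normal in `F`: `Q ≤ S` and `N_F(Q) = F`. -/
def Normal (F : FusionSystem P) (Q : Subgroup P) : Prop :=
  ∃ hQ : Q ≤ F.carrier, F.normalizer Q hQ = F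

/-- `F` is constrained: it has a normal `F`-centric subgroup. -/
def Constrained (F : FusionSystem P) : Prop := ∃ Q : Subgroup P, F.Normal Q ∧ F.Centric Q

/-- A nontrivial saturated fusion system `F` is extremely sparse if the only proper (saturated)
subsystem of `F` on any subgroup `Q` of its carrier is `F_Q(Q)`. -/
structure ExtremelySparse (p : ℕ) (F : FusionSystem P) : Prop where
  saturated : F.IsSaturated p
  nontrivial : ¬ F.IsTrivial
  subsystem : ∀ G : FusionSystem P, G.IsSaturated p → G.IsSubsystem F → G ≠ F → G.IsTrivial

end FusionSystem

namespace FusionSystem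

variable {P : Type*} [Group P]

/-! A single automorphism of order prime to `p` already generates a nontrivial saturated subsystem,
and an extremely sparse system must coincide with it.

By the Frobenius criterion (`IsSaturated.isTrivial_of_isPGroup_aut`), a nontrivial saturated system
`F` has some `Aut_F(Q)` that is not a `p`-group, hence some `α` in it of prime order `q ≠ p`. Put `A
= Inn(Q)⟨α⟩` and let `G` be the system on `Q` formed by restrictions of elements of `A`. It is
saturated: `Inn(Q)` is Sylow in `A`, and every morphism extends to all of `Q` by construction. It is
not trivial, as inner automorphisms of `Q` have `p`-power order. So `G = F`; thus `Q` is the whole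
carrier of `F`, and it is normal and centric.

The Frobenius criterion is a downward induction on `|Q|`. Above `Q` all morphisms are conjugations,
and `Q` is properly contained in its normalizer, so a morphism that extends to the normalizer is a
conjugation. -/

/-! ### Inner automorphisms, morphisms and fully normalized subgroups -/

theorem mem_innerAut {S Q : Subgroup P} {hQ : Q ≤ S} {α : MulAut Q} :
    α ∈ innerAut S Q hQ ↔ ∃ g ∈ S, ∀ x : Q, (α x : P) = g * x * g⁻¹ :=
  ⟨fun h => h.2.2, fun h => ⟨hQ, hQ, h⟩⟩

theorem exists_mem_innerAut {S Q : Subgroup P} (hQ : Q ≤ S) {g : P} (hg : g ∈ normIn S Q) :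
    ∃ γ ∈ innerAut S Q hQ, ∀ x : Q, (γ x : P) = g * x * g⁻¹ := by
  let γ : MulAut Q := Subgroup.normalizerMonoidHom Q ⟨g, hg.2⟩
  have hγ : ∀ x : Q, (γ x : P) = g * x * g⁻¹ := fun _ => rfl
  exact ⟨γ, mem_innerAut.2 ⟨g, hg.1, hγ⟩, hγ⟩

theorem innerAut_le_aut (F : FusionSystem P) {Q : Subgroup P} (hQ : Q ≤ F.carrier) :
    innerAut F.carrier Q hQ ≤ F.aut Q hQ := fun α hα => by
  obtain ⟨g, hg, h⟩ := mem_innerAut.1 hα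
  exact F.conj_mem _ hQ hQ g hg h

/-- Every morphism of a fusion system is an isomorphism onto its image. -/
theorem exists_mulEquiv_of_mem (F : FusionSystem P) {Q R : Subgroup P} {φ : Q →* R}
    (hφ : φ ∈ F.Hom Q R) :
    ∃ e : Q ≃* Fusion.image φ Q, e.toMonoidHom ∈ F.Hom Q (Fusion.image φ Q) ∧
      ∀ x, (e x : P) = φ x := by
  let f : Q →* P := R.subtype.comp φ
  have hf : Function.Injective f := Subtype.val_injective.comp (F.injective hφ)
  have hr : f.range = Fusion.image φ Q := by
    ext y
    rw [Fusion.mem_image]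
    exact ⟨fun ⟨x, hx⟩ => ⟨x, x.2, hx⟩, fun ⟨x, _, hx⟩ => ⟨x, hx⟩⟩
  let e : Q ≃* Fusion.image φ Q := (MonoidHom.ofInjective hf).trans (MulEquiv.subgroupCongr hr)
  exact ⟨e, (F.iso_mem e hφ fun _ => rfl).1, fun _ => rfl⟩

/-- Membership in a fusion system does not depend on the codomain. -/
theorem mem_hom_of_eq (F : FusionSystem P) {Q R T : Subgroup P} {φ : Q →* R} (hφ : φ ∈ F.Hom Q R)
    (hT : T ≤ F.carrier) (ψ : Q →* T) (h : ∀ x, (ψ x : P) = φ x) : ψ ∈ F.Hom Q T := by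
  obtain ⟨e, he, hex⟩ := F.exists_mulEquiv_of_mem hφ
  have hle : Fusion.image φ Q ≤ T := fun y hy => by
    obtain ⟨x, _, rfl⟩ := (Fusion.mem_image _ _ _).1 hy
    exact h x ▸ (ψ x).2
  have : ψ = (Subgroup.inclusion hle).comp e.toMonoidHom :=
    MonoidHom.ext fun x => Subtype.ext ((h x).trans (hex x).symm)
  exact this ▸ F.comp_mem he (F.inclusion_mem hle hT)

theorem IsIsomorphic.trans {F : FusionSystem P} {Q R T : Subgroup P} (h : F.IsIsomorphic Q R)
    (h' : F.IsIsomorphic R T) : F.IsIsomorphic Q T := by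
  obtain ⟨e, he⟩ := h
  obtain ⟨e', he'⟩ := h'
  exact ⟨e.trans e', F.comp_mem he he'⟩

theorem exists_fullyNormalized [Finite P] (F : FusionSystem P) {Q : Subgroup P}
    (hQ : Q ≤ F.carrier) : ∃ R, F.IsIsomorphic Q R ∧ F.FullyNormalized R := by
  have hne : {R | F.IsIsomorphic Q R}.Nonempty := ⟨Q, MulEquiv.refl Q, F.inclusion_mem le_rfl hQ⟩
  obtain ⟨R, hR, hmax⟩ := Set.exists_max_image _ (fun R => Nat.card (normIn F.carrier R))
    (Set.toFinite _) hne
  refine ⟨R, hR, ?_, fun T hT => hmax T (IsIsomorphic.trans hR hT)⟩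
  obtain ⟨e, he⟩ := hR
  exact F.le_carrier_right he

theorem lt_normIn [Finite P] {p : ℕ} [Fact p.Prime] (hP : IsPGroup p P) {S Q : Subgroup P}
    (h : Q < S) : Q < normIn S Q := by
  have := hP.isNilpotent
  have := (hP.to_subgroup S).isNilpotent
  have hlt : Q.subgroupOf S < ⊤ := lt_top_iff_ne_top.2 fun h' =>
    h.not_ge (Subgroup.subgroupOf_eq_top.1 h')
  have h1 := Group.normalizerCondition_of_isNilpotent _ hlt
  rw [← Subgroup.subgroupOf_normalizer_eq h.le] at h1
  obtain ⟨x, hx, hx'⟩ := SetLike.exists_of_lt h1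
  exact SetLike.lt_iff_le_and_exists.2 ⟨le_inf h.le Subgroup.le_normalizer,
    (x : P), show (x : P) ∈ normIn S Q from ⟨x.2, hx⟩, hx'⟩

/-! ### The Frobenius criterion -/

/-- In a saturated fusion system, an isomorphism `e` of proper subgroups onto a fully normalized
one that carries conjugations to conjugations is itself a conjugation, provided that this holds for
all morphisms on larger subgroups. -/
theorem IsSaturated.exists_conj_of_forall_lt [Finite P] {p : ℕ} [Fact p.Prime] (hP : IsPGroup p P)
    {F : FusionSystem P} (hF : F.IsSaturated p) {Q R : Subgroup P}
    (ih : ∀ T : Subgroup P, Q < T → ∀ φ ∈ F.Hom T F.carrier,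
      ∃ g ∈ F.carrier, ∀ x, (φ x : P) = g * x * g⁻¹)
    (hQ : Q < F.carrier) (e : Q ≃* R) (he : e.toMonoidHom ∈ F.Hom Q R)
    (hR : F.FullyNormalized R)
    (hext : ∀ g ∈ normIn F.carrier Q, ∃ h ∈ F.carrier, ∀ x y : Q, (y : P) = g * x * g⁻¹ →
      (e y : P) = h * e x * h⁻¹) :
    ∃ g ∈ F.carrier, ∀ x, (e x : P) = g * x * g⁻¹ := by
  set φ : Q →* F.carrier := (Subgroup.inclusion hR.1).comp e.toMonoidHom
  have hφ : φ ∈ F.Hom Q F.carrier := F.comp_mem he (F.inclusion_mem hR.1 le_rfl)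
  have himage : Fusion.image φ Q = R := by
    ext y
    rw [Fusion.mem_image]
    refine ⟨?_, fun hy => ⟨e.symm ⟨y, hy⟩, (e.symm _).2, ?_⟩⟩
    · rintro ⟨x, _, rfl⟩
      exact (e x).2
    · change ((e (e.symm ⟨y, hy⟩) : R) : P) = y
      rw [e.apply_symm_apply]
  obtain ⟨ψ, hψ, hle, hψφ⟩ := hF.extension Q φ hφ (himage.symm ▸ hR)
  -- By `hext`, the extender is all of `N_S(Q)`, which is strictly larger than `Q` because
  -- normalizers grow in a `p`-group.
  have hlt : Q < extender F.carrier φ :=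
    (lt_normIn hP hQ).trans_le fun g hg => ⟨hg, hext g hg⟩
  obtain ⟨g, hg, h⟩ := ih _ hlt ψ hψ
  exact ⟨g, hg, fun x => (hψφ x).symm.trans (h _)⟩

/-- If `R` is fully normalized and `Aut_F(R)` is a `p`-group, then `Aut_F(R) = Aut_S(R)`, provided
that morphisms on larger subgroups are conjugations. -/
theorem IsSaturated.aut_le_innerAut [Finite P] {p : ℕ} [Fact p.Prime] (hP : IsPGroup p P)
    {F : FusionSystem P} (hF : F.IsSaturated p) {R : Subgroup P}
    (ih : ∀ T : Subgroup P, R < T → ∀ φ ∈ F.Hom T F.carrier,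
      ∃ g ∈ F.carrier, ∀ x, (φ x : P) = g * x * g⁻¹)
    (hlt : R < F.carrier) (hR : F.FullyNormalized R) (hA : IsPGroup p (F.aut R hlt.le)) :
    F.aut R hlt.le ≤ innerAut F.carrier R hlt.le := by
  by_contra hne
  have := hA.isNilpotent
  -- Normalizers grow in the nilpotent group `Aut_F(R)` too: some `α` outside `Aut_S(R)` normalizes
  -- it. Normalizing `Aut_S(R)` is what lets `α` extend to `N_S(R)`, and this forces `α` into
  -- `Aut_S(R)`.
  obtain ⟨α, hα, hα'⟩ := SetLike.exists_of_lt
    (Group.normalizerCondition_of_isNilpotent _ (lt_top_iff_ne_top.2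
      fun h => hne (Subgroup.subgroupOf_eq_top.1 h)))
  refine hα' (Subgroup.mem_subgroupOf.2 (mem_innerAut.2
    (hF.exists_conj_of_forall_lt hP ih hlt (α : MulAut R) α.2 hR fun g hg => ?_)))
  obtain ⟨γ, hγi, hγ⟩ := exists_mem_innerAut hlt.le hg
  have h1 := (Subgroup.mem_normalizer_iff.1 hα ⟨γ, F.innerAut_le_aut _ hγi⟩).1 hγi
  obtain ⟨h, hh, h2⟩ := mem_innerAut.1 (Subgroup.mem_subgroupOf.1 h1)
  refine ⟨h, hh, fun x y hxy => ?_⟩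
  have h3 := h2 ((α : MulAut R) x)
  have h4 : γ x = y := Subtype.ext ((hγ x).trans hxy.symm)
  rw [← h3, ← h4]
  simp

/-- The Frobenius criterion: a saturated fusion system in which all automorphism groups are
`p`-groups is trivial. -/
theorem IsSaturated.exists_conj [Finite P] {p : ℕ} [Fact p.Prime] (hP : IsPGroup p P)
    {F : FusionSystem P} (hF : F.IsSaturated p) (hA : ∀ Q hQ, IsPGroup p (F.aut Q hQ))
    (Q : Subgroup P) : ∀ φ ∈ F.Hom Q F.carrier, ∃ g ∈ F.carrier, ∀ x, (φ x : P) = g * x * g⁻¹ := by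
  induction hn : Nat.card P - Nat.card Q using Nat.strong_induction_on generalizing Q with
  | _ n ih =>
  subst hn
  -- Stated for every `R` of the order of `Q`, since it is also needed above the fully normalized
  -- conjugate of `Q` and above `φ(Q)`.
  have ih' : ∀ R : Subgroup P, Nat.card R = Nat.card Q → ∀ T : Subgroup P, R < T →
      ∀ φ ∈ F.Hom T F.carrier, ∃ g ∈ F.carrier, ∀ x, (φ x : P) = g * x * g⁻¹ := by
    intro R hR T hT
    have h1 : Nat.card R < Nat.card T := Set.ncard_lt_ncard hT (Set.toFinite _)
    have h2 : Nat.card T ≤ Nat.card P := Subgroup.card_le_card_group T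
    exact ih _ (by omega) T rfl
  intro φ hφ
  obtain rfl | hlt := (F.le_carrier_left hφ).eq_or_lt
  · let α : MulAut F.carrier :=
      MulEquiv.ofBijective φ (Finite.injective_iff_bijective.1 (F.injective hφ))
    obtain ⟨T, hT⟩ := hF.sylow
    -- The whole automorphism group is a `p`-group, so it equals its Sylow subgroup `Aut_S(S)`.
    have h1 : (⊤ : Subgroup (F.aut F.carrier le_rfl)) = T :=
      T.is_maximal' ((hA _ _).to_subgroup ⊤) le_top
    rw [hT] at h1
    exact mem_innerAut.1 (Subgroup.subgroupOf_eq_top.1 h1.symm (show α ∈ _ from hφ))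
  · obtain ⟨R, ⟨e, he⟩, hR⟩ := F.exists_fullyNormalized hlt.le
    have card_eq {T T' : Subgroup P} (f : T ≃* T') : Nat.card T' = Nat.card T :=
      (Nat.card_congr f.toEquiv).symm
    have lt_of_equiv {T : Subgroup P} (f : Q ≃* T) (hT : T ≤ F.carrier) : T < F.carrier := by
      refine hT.lt_of_ne ?_
      rintro rfl
      have h1 : Nat.card Q < Nat.card F.carrier := Set.ncard_lt_ncard hlt (Set.toFinite _)
      exact h1.ne (card_eq f).symm
    have hRlt := lt_of_equiv e hR.1
    have haut := hF.aut_le_innerAut hP (ih' R (card_eq e)) hRlt hR (hA _ _)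
    -- Any `f` onto `R` extends to the normalizer: `f` carries `Aut_S(T)` into `Aut_F(R)`, which
    -- equals `Aut_S(R)`.
    have key : ∀ T : Subgroup P, Nat.card T = Nat.card Q → T < F.carrier →
        ∀ f : T ≃* R, f.toMonoidHom ∈ F.Hom T R →
          ∃ g ∈ F.carrier, ∀ x, (f x : P) = g * x * g⁻¹ := by
      intro T hT hTlt f hf
      refine hF.exists_conj_of_forall_lt hP (ih' T hT) hTlt f hf hR fun g hg => ?_
      obtain ⟨δ, hδ, hδg⟩ := exists_mem_innerAut hTlt.le hg
      have hβ : (f.symm.trans (δ.trans f) : MulAut R) ∈ F.aut R hRlt.le :=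
        F.comp_mem (F.comp_mem (F.iso_mem f hf fun _ => rfl).2 (F.innerAut_le_aut _ hδ)) hf
      obtain ⟨h, hh, h1⟩ := mem_innerAut.1 (haut hβ)
      refine ⟨h, hh, fun x y hxy => ?_⟩
      have h2 : δ x = y := Subtype.ext ((hδg x).trans hxy.symm)
      rw [← h1 (f x)]
      simp [h2]
    obtain ⟨d, hd, hdφ⟩ := F.exists_mulEquiv_of_mem hφ
    -- As `φ(Q)` need not be fully normalized, `φ` is compared through `R`: `e` is conjugation by
    -- `a`, the induced map `φ(Q) → R` is conjugation by `b`, hence `φ` is conjugation by `b⁻¹ * a`.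
    obtain ⟨a, ha, h1⟩ := key Q rfl hlt e he
    obtain ⟨b, hb, h2⟩ := key _ (card_eq d) (lt_of_equiv d (F.le_carrier_right hd))
      (d.symm.trans e) (F.comp_mem (F.iso_mem d hd fun _ => rfl).2 he)
    refine ⟨b⁻¹ * a, mul_mem (inv_mem hb) ha, fun x => ?_⟩
    have h3 := h2 (d x)
    simp only [MulEquiv.trans_apply, MulEquiv.symm_apply_apply, h1, hdφ] at h3
    calc (φ x : P) = b⁻¹ * (b * φ x * b⁻¹) * b := by group
      _ = b⁻¹ * a * x * (b⁻¹ * a)⁻¹ := by rw [← h3]; group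

theorem IsSaturated.isTrivial_of_isPGroup_aut [Finite P] {p : ℕ} [Fact p.Prime]
    (hP : IsPGroup p P) {F : FusionSystem P} (hF : F.IsSaturated p)
    (hA : ∀ Q hQ, IsPGroup p (F.aut Q hQ)) : F.IsTrivial := by
  refine FusionSystem.ext rfl (funext fun Q => funext fun R => Set.ext fun φ => ⟨fun hφ => ?_, ?_⟩)
  · have hR := F.le_carrier_right hφ
    obtain ⟨g, hg, h⟩ := hF.exists_conj hP hA Q _ (F.comp_mem hφ (F.inclusion_mem hR le_rfl))
    exact ⟨F.le_carrier_left hφ, hR, g, hg, h⟩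
  · rintro ⟨hQ, hR, g, hg, h⟩
    exact F.conj_mem φ hQ hR g hg h

/-! ### Fusion systems given by automorphisms of one subgroup -/

/-- The fusion system on `Q` whose morphisms are the restrictions of the elements of a group `A` of
automorphisms of `Q` containing the inner ones. -/
def ofAut (Q : Subgroup P) (A : Subgroup (MulAut Q)) (hA : innerAut Q Q le_rfl ≤ A) :
    FusionSystem P where
  carrier := Q
  Hom R T := {φ | T ≤ Q ∧ ∃ h : R ≤ Q, ∃ β ∈ A, ∀ x : R, (φ x : P) = β (Subgroup.inclusion h x)}
  le_carrier_left h := h.2.1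
  le_carrier_right h := h.1
  injective := by
    rintro R T φ ⟨_, h, β, _, hβ⟩ x y hxy
    have h1 := hβ x
    rw [hxy, hβ y] at h1
    exact Subgroup.inclusion_injective h (β.injective (Subtype.ext h1.symm))
  comp_mem := by
    rintro R T U φ ψ ⟨_, hR, β, hβ, h⟩ ⟨hU, hT, γ, hγ, h'⟩
    refine ⟨hU, hR, γ * β, A.mul_mem hγ hβ, fun x => ?_⟩
    have h1 : Subgroup.inclusion hT (φ x) = β (Subgroup.inclusion hR x) := Subtype.ext (h x)
    rw [MonoidHom.comp_apply, h', h1, MulAut.mul_apply]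
  inclusion_mem h hR := ⟨hR, h.trans hR, 1, A.one_mem, fun x => rfl⟩
  iso_mem := by
    rintro R T U φ e ⟨hT, hR, β, hβ, h⟩ he
    have hU : U ≤ Q := by
      intro y hy
      have h1 := he (e.symm ⟨y, hy⟩)
      rw [e.apply_symm_apply] at h1
      rw [show y = _ from h1]
      exact hT (φ _).2
    refine ⟨⟨hU, hR, β, hβ, fun x => (he x).trans (h x)⟩,
      ⟨hR, hU, β⁻¹, A.inv_mem hβ, fun y => ?_⟩⟩
    have h1 := (he (e.symm y)).trans (h _)
    rw [e.apply_symm_apply] at h1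
    rw [show Subgroup.inclusion hU y = β (Subgroup.inclusion hR (e.symm y)) from Subtype.ext h1,
      MulAut.inv_apply_self]
    rfl
  conj_mem φ hR hT g hg h := by
    refine ⟨hT, hR, MulAut.conj ⟨g, hg⟩, hA (mem_innerAut.2 ⟨g, hg, fun x => rfl⟩), fun x => ?_⟩
    rw [h x]
    rfl

section ofAut

variable {Q : Subgroup P} {A : Subgroup (MulAut Q)} {hA : innerAut Q Q le_rfl ≤ A}

theorem aut_ofAut : (ofAut Q A hA).aut Q le_rfl = A := by
  ext α
  constructor
  · rintro ⟨_, _, β, hβ, h⟩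
    have : α = β := MulEquiv.ext fun x => Subtype.ext (h x)
    exact this ▸ hβ
  · exact fun h => ⟨le_rfl, le_rfl, α, h, fun x => rfl⟩

theorem ofAut_isSubsystem (F : FusionSystem P) (hQ : Q ≤ F.carrier) (hF : A ≤ F.aut Q hQ) :
    (ofAut Q A hA).IsSubsystem F := by
  refine ⟨hQ, fun R T φ hφ => ?_⟩
  obtain ⟨hT, hR, β, hβ, h⟩ := hφ
  exact F.mem_hom_of_eq (F.comp_mem (F.inclusion_mem hR hQ) (hF hβ)) (hT.trans hQ) φ h

/-- The extension axiom costs nothing: each morphism is a restriction of some `β ∈ A`, and `β`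
restricts to the extender as well. Only the Sylow axiom needs a hypothesis. -/
theorem ofAut_isSaturated {p : ℕ} (T : Sylow p A)
    (hT : (T : Subgroup A) = (innerAut Q Q le_rfl).subgroupOf A) :
    (ofAut Q A hA).IsSaturated p where
  sylow := by
    -- Generalizing over `B` allows transport along `aut_ofAut`, on which the type of the Sylow
    -- subgroup depends.
    have h : ∀ B : Subgroup (MulAut Q), B = A → ∃ T : Sylow p B,
        (T : Subgroup B) = (innerAut Q Q le_rfl).subgroupOf B := by
      rintro _ rfl
      exact ⟨T, hT⟩
    exact h _ aut_ofAut
  extension := by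
    rintro R φ ⟨_, hR, β, hβ, h⟩ _
    have hE : extender Q φ ≤ Q := fun g hg => hg.1.1
    -- For `g ∈ R` the conjugating element is `φ(g)`.
    have hle : R ≤ extender Q φ := fun g hg => by
      refine ⟨⟨hR hg, Subgroup.le_normalizer (H := R) hg⟩, _, (φ ⟨g, hg⟩).2, fun x y hxy => ?_⟩
      have : y = (⟨g, hg⟩ : R) * x * (⟨g, hg⟩ : R)⁻¹ := Subtype.ext hxy
      simp [this]
    exact ⟨β.toMonoidHom.comp (Subgroup.inclusion hE), ⟨le_rfl, hE, β, hβ, fun x => rfl⟩,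
      hle, fun x => (h x).symm⟩

theorem le_innerAut_of_isTrivial_ofAut (h : (ofAut Q A hA).IsTrivial) :
    A ≤ innerAut Q Q le_rfl := by
  intro α hα
  have h2 : α.toMonoidHom ∈ (ofAut Q A hA).Hom Q Q :=
    (SetLike.ext_iff.1 (aut_ofAut (hA := hA)) α).2 hα
  rw [show ofAut Q A hA = inner Q from h] at h2
  exact h2

theorem ofAut_normal : (ofAut Q A hA).Normal Q := by
  have hN : normIn Q Q = Q := inf_eq_left.2 Subgroup.le_normalizer
  refine ⟨le_rfl, FusionSystem.ext hN (funext fun R => funext fun T => Set.ext fun φ =>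
    ⟨fun h => h.2.2.1, fun hφ => ?_⟩)⟩
  obtain ⟨hT, hR, β, hβ, h⟩ := id hφ
  have h1 : Q ⊔ R ≤ Q := sup_le le_rfl hR
  have h2 : Q ⊔ T ≤ Q := sup_le le_rfl hT
  have h3 : Q ≤ Q ⊔ T := le_sup_left
  refine ⟨hR.trans hN.ge, hT.trans hN.ge, hφ,
    (Subgroup.inclusion h3).comp (β.toMonoidHom.comp (Subgroup.inclusion h1)),
    ⟨h2, h1, β, hβ, fun x => rfl⟩, ⟨le_sup_right, fun x => (h x).symm⟩, ?_⟩
  ext y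
  rw [Fusion.mem_image]
  constructor
  · rintro ⟨x, _, rfl⟩
    exact (β _).2
  · intro hy
    refine ⟨Subgroup.inclusion le_sup_left (β⁻¹ ⟨y, hy⟩), (β⁻¹ ⟨y, hy⟩).2, ?_⟩
    change ((β (β⁻¹ ⟨y, hy⟩) : Q) : P) = y
    rw [MulAut.apply_inv_self]

end ofAut

/-! ### The subsystem generated by a `p'`-automorphism, and the theorem -/

theorem centric_carrier [Finite P] (F : FusionSystem P) : F.Centric F.carrier := by
  refine ⟨le_rfl, fun R ⟨e, he⟩ => ?_⟩
  have : R = F.carrier := Subgroup.eq_of_le_of_card_ge (F.le_carrier_right he)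
    (Nat.card_congr e.toEquiv).le
  exact this ▸ inf_le_left

/-- In `Inn(Q)⟨α⟩`, where the order of `α` is prime to `p`, the group `Inn(Q)` of a `p`-group `Q`
is a Sylow `p`-subgroup. -/
theorem exists_sylow_innerAut_sup_zpowers [Finite P] {p : ℕ} [Fact p.Prime] (hP : IsPGroup p P)
    (Q : Subgroup P) (α : MulAut Q) (hα : ¬ p ∣ orderOf α) :
    ∃ T : Sylow p ↥(innerAut Q Q le_rfl ⊔ Subgroup.zpowers α), (T : Subgroup _) =
      (innerAut Q Q le_rfl).subgroupOf (innerAut Q Q le_rfl ⊔ Subgroup.zpowers α) := by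
  have hI : innerAut Q Q le_rfl = (MulAut.conj : Q →* MulAut Q).range := by
    ext β
    rw [mem_innerAut]
    exact ⟨fun ⟨g, hg, h⟩ => ⟨⟨g, hg⟩, MulEquiv.ext fun x => Subtype.ext (h x).symm⟩,
      fun ⟨g, h⟩ => ⟨g, g.2, fun x => h ▸ rfl⟩⟩
  have hp : IsPGroup p (innerAut Q Q le_rfl) := by
    rw [hI]
    exact (hP.to_subgroup Q).of_surjective _ MulAut.conj.rangeRestrict_surjective
  have hnormal : (innerAut Q Q le_rfl).Normal := by
    rw [hI]
    refine ⟨?_⟩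
    rintro _ ⟨g, rfl⟩ β
    exact ⟨β g, MulEquiv.ext fun x => by simp [MulAut.mul_apply]⟩
  have hindex : ¬ p ∣ ((innerAut Q Q le_rfl).subgroupOf
      (innerAut Q Q le_rfl ⊔ Subgroup.zpowers α)).index := fun h => by
    change p ∣ (innerAut Q Q le_rfl).relIndex _ at h
    -- As `Inn(Q)` is normal, its index in `Inn(Q)⟨α⟩` is its relative index in `⟨α⟩`, which divides
    -- the order of `α`.
    rw [Subgroup.relIndex_sup_left] at h
    exact hα (Nat.card_zpowers α ▸ h.trans (Subgroup.relIndex_dvd_card _ _))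
  exact ⟨(hp.comap_subtype).toSylow hindex, rfl⟩

end FusionSystem

/-- Every extremely sparse (saturated) fusion system on a finite `p`-group is constrained, for
every prime `p`. (The case of a fusion system on all of `P` is `F.carrier = ⊤`.) -/
theorem mainTheorem5 (p : ℕ) [Fact p.Prime] {P : Type*} [Group P] [Finite P] (hP : IsPGroup p P)
    (F : FusionSystem P) (hF : F.ExtremelySparse p) : F.Constrained := by
  obtain ⟨Q, hQ, hAut⟩ : ∃ Q, ∃ hQ : Q ≤ F.carrier, ¬ IsPGroup p (F.aut Q hQ) := by
    by_contra! h
    exact hF.nontrivial (hF.saturated.isTrivial_of_isPGroup_aut hP h)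
  obtain ⟨q, hq, hqdvd, hqp⟩ : ∃ q, q.Prime ∧ q ∣ Nat.card (F.aut Q hQ) ∧ q ≠ p := by
    by_contra! h
    exact hAut (IsPGroup.of_card
      (Nat.eq_prime_pow_of_unique_prime_dvd Nat.card_pos.ne' fun hd hdvd => h _ hd hdvd))
  have := Fact.mk hq
  obtain ⟨α, hα⟩ := exists_prime_orderOf_dvd_card' q hqdvd
  have hα' : orderOf (α : MulAut Q) = q := by rw [Subgroup.orderOf_coe, hα]
  have hpα : ¬ p ∣ orderOf (α : MulAut Q) := by
    rw [hα', Nat.prime_dvd_prime_iff_eq Fact.out hq]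
    exact hqp.symm
  let A := FusionSystem.innerAut Q Q le_rfl ⊔ Subgroup.zpowers (α : MulAut Q)
  obtain ⟨T, hT⟩ := FusionSystem.exists_sylow_innerAut_sup_zpowers hP Q α hpα
  have hAF : A ≤ F.aut Q hQ := sup_le
    (fun β hβ => by
      obtain ⟨g, hg, h⟩ := FusionSystem.mem_innerAut.1 hβ
      exact F.conj_mem _ hQ hQ g (hQ hg) h)
    (Subgroup.zpowers_le.2 α.2)
  let G := FusionSystem.ofAut Q A le_sup_left
  have hG : G = F := by
    by_contra hne
    have htriv := hF.subsystem G (FusionSystem.ofAut_isSaturated T hT)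
      (FusionSystem.ofAut_isSubsystem F hQ hAF) hne
    have hmem := FusionSystem.le_innerAut_of_isTrivial_ofAut htriv
      (Subgroup.mem_sup_right (Subgroup.mem_zpowers (α : MulAut Q)))
    obtain ⟨g, hg, h⟩ := FusionSystem.mem_innerAut.1 hmem
    have hconj : (α : MulAut Q) = MulAut.conj ⟨g, hg⟩ :=
      MulEquiv.ext fun x => Subtype.ext (h x)
    -- If `α` were conjugation by `g ∈ Q`, its order `q` would divide a power of `p`.
    obtain ⟨k, hk⟩ := (hP.to_subgroup Q) ⟨g, hg⟩
    have h1 : (α : MulAut Q) ^ p ^ k = 1 := by rw [hconj, ← map_pow, hk, map_one]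
    have h2 : q ∣ p ^ k := hα' ▸ orderOf_dvd_of_pow_eq_one h1
    exact hqp ((Nat.prime_dvd_prime_iff_eq hq Fact.out).1 (hq.dvd_of_dvd_pow h2))
  rw [← hG]
  exact ⟨Q, FusionSystem.ofAut_normal, G.centric_carrier⟩
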